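/- A statistical decision problem consists of a parameter space $\Theta$, measurable spaces $X$ (samples) and $A$ (actions), a loss function $\ell:\Theta\times A\to[0,\infty)$ measurable in its second argument, and a family $(P_\theta)_{\theta\in\Theta}$ of probability measures on $X$. Let $\mathcal D$ be the set of randomized decision procedures, i.e. of maps $\delta$ from $X$ to the probability measures on $A$ such that $x\mapsto\int_A \ell(\theta,a)\,\delta(x,\mathrm da)$ is measurable for every $\theta\in\Theta$. The risk is $$r(\theta,\delta)=\int_X\Bigl[\int_A \ell(\theta,a)\,\delta(x,\mathrm da)\Bigr]P_\theta(\mathrm dx)\in[0,\infty],$$ and $r(\pi,\delta)=\int_\Theta r(\theta,\delta)\,\pi(\mathrm d\theta)$ for a (countably or finitely additive) prior $\pi$ on $\Theta$. Let $\mathcal M_1(\Theta)$ be the set of countably additive probability measures on the Borel $\sigma$-algebra of $\Theta$, and let $\mathcal M_1^{fa}(\Theta)$ be the set of finitely additive probability measures on the Borel $\sigma$-algebra of $\Theta$. **Theorem.** Suppose that $\Theta$ is a nonempty, totally bounded, separable metric space, that $\inf_{\delta\in\mathcal D}\sup_{\theta\in\Theta}r(\theta,\delta)<\infty$, and that there is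 $k\in\mathbb N$ such that, for every $\delta\in\mathcal D$, the risk function $r(\cdot,\delta)$ is real-valued and $k$-Lipschitz on $\Theta$. Then $$\inf_{\delta\in\mathcal D}\sup_{\theta\in\Theta}r(\theta,\delta)=\sup_{\pi\in\mathcal M_1(\Theta)}\inf_{\delta\in\mathcal D}r(\pi,\delta)=\sup_{\pi\in\mathcal M_1^{fa}(\Theta)}\inf_{\delta\in\mathcal D}r(\pi,\delta),$$ and the last equality also holds if $\mathcal M_1^{fa}(\Theta)$ is replaced by the set of finitely additive probability measures on all subsets of $\Theta$. Moreover, there is a sequence $(\pi_n)_{n\in\mathbb N}$ of finitely supported probability measures on $\Theta$ such that $$\lim_{n\to\infty}\inf_{\delta\in\mathcal D}r(\pi_n,\delta)=\inf_{\delta\in\mathcal D}\sup_{\theta\in\Theta}r(\theta,\delta).$$ -/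

import Mathlib

open MeasureTheory Filter
open scoped ENNReal NNReal Topology

/-- A (non-sequential) statistical decision problem: a parameter space `Θ`, a measurable sample
space `X`, a measurable action space `A`, a nonnegative loss `ℓ(θ, a)`, and a family
`(P_θ)` of probability measures on `X`. The loss is measurable in the action, so that the
expected loss of a randomized action is meaningful. -/
structure DecisionProblem (Θ X A : Type*) [MeasurableSpace X] [MeasurableSpace A] where
  loss : Θ → A → ℝ≥0
  measurable_loss : ∀ θ, Measurable (loss θ)
  model : Θ → ProbabilityMeasure X

namespace DecisionProblem

/-- A randomized decision procedure: a map `δ` from the sample space to the probability measures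
on the action space such that `x ↦ ∫ ℓ(θ, a) δ(x, da)` is measurable for every `θ`. -/
structure Procedure {Θ X A : Type*} [MeasurableSpace X] [MeasurableSpace A]
    (dp : DecisionProblem Θ X A) where
  toFun : X → ProbabilityMeasure A
  measurable_expectedLoss :
    ∀ θ, Measurable fun x => ∫⁻ a, (dp.loss θ a : ℝ≥0∞) ∂(toFun x : Measure A)

/-- The risk `r(θ, δ) = ∫ [∫ ℓ(θ, a) δ(x, da)] P_θ(dx)`, an element of `[0, ∞]`. -/
noncomputable def risk {Θ X A : Type*} [MeasurableSpace X] [MeasurableSpace A]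
    (dp : DecisionProblem Θ X A) (θ : Θ) (δ : dp.Procedure) : ℝ≥0∞ :=
  ∫⁻ x, ∫⁻ a, (dp.loss θ a : ℝ≥0∞) ∂(δ.toFun x : Measure A) ∂(dp.model θ : Measure X)

/-- The minimax value `inf_δ sup_θ r(θ, δ)`. -/
noncomputable def minimaxValue {Θ X A : Type*} [MeasurableSpace X] [MeasurableSpace A]
    (dp : DecisionProblem Θ X A) : ℝ≥0∞ :=
  ⨅ δ : dp.Procedure, ⨆ θ : Θ, dp.risk θ δ

/-- The Bayes risk `r(π, δ) = ∫ r(θ, δ) π(dθ)` for a countably additive prior. -/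
noncomputable def bayesRisk {Θ X A : Type*} [MeasurableSpace Θ] [MeasurableSpace X]
    [MeasurableSpace A] (dp : DecisionProblem Θ X A) (π : ProbabilityMeasure Θ)
    (δ : dp.Procedure) : ℝ≥0∞ :=
  ∫⁻ θ, dp.risk θ δ ∂(π : Measure Θ)

/-- The Bayes value `r_π = inf_δ r(π, δ)` of a countably additive prior. -/
noncomputable def bayesValue {Θ X A : Type*} [MeasurableSpace Θ] [MeasurableSpace X]
    [MeasurableSpace A] (dp : DecisionProblem Θ X A) (π : ProbabilityMeasure Θ) : ℝ≥0∞ :=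
  ⨅ δ : dp.Procedure, dp.bayesRisk π δ

/-- The function `r(·, δ)` is real-valued and `k`-Lipschitz. -/
def RiskLipschitz {Θ X A : Type*} [PseudoEMetricSpace Θ] [MeasurableSpace X] [MeasurableSpace A]
    (dp : DecisionProblem Θ X A) (k : ℝ≥0) (δ : dp.Procedure) : Prop :=
  (∀ θ, dp.risk θ δ ≠ ∞) ∧ LipschitzWith k fun θ => (dp.risk θ δ).toReal

end DecisionProblem

/-- A finitely additive probability measure on the `σ`-algebra `m`. Only the values on the sets
of `m` carry information. -/
structure FinAddProb {Θ : Type*} (m : MeasurableSpace Θ) where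
  content : AddContent ℝ≥0∞ {s : Set Θ | MeasurableSet[m] s}
  content_univ : content Set.univ = 1

/-- The integral of a function `f : Θ → [0, ∞]` with respect to a finitely additive probability:
the supremum of the elementary integrals `∑ y · π(g = y)` of the `m`-measurable simple functions
`g ≤ f`. For bounded `m`-measurable `f` this is the usual integral. -/
noncomputable def FinAddProb.integral {Θ : Type*} {m : MeasurableSpace Θ} (π : FinAddProb m)
    (f : Θ → ℝ≥0∞) : ℝ≥0∞ :=
  ⨆ (g : SimpleFunc Θ ℝ≥0∞) (_ : ∀ θ, g θ ≤ f θ), ∑ y ∈ g.range, y * π.content (g ⁻¹' {y})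

namespace DecisionProblem

/-- The Bayes risk `r(π, δ) = ∫ r(θ, δ) π(dθ)` for a finitely additive prior. -/
noncomputable def finAddBayesRisk {Θ X A : Type*} [MeasurableSpace X] [MeasurableSpace A]
    {m : MeasurableSpace Θ} (dp : DecisionProblem Θ X A) (π : FinAddProb m)
    (δ : dp.Procedure) : ℝ≥0∞ :=
  π.integral fun θ => dp.risk θ δ

/-- The Bayes value `inf_δ r(π, δ)` of a finitely additive prior. -/
noncomputable def finAddBayesValue {Θ X A : Type*} [MeasurableSpace X] [MeasurableSpace A]
    {m : MeasurableSpace Θ} (dp : DecisionProblem Θ X A) (π : FinAddProb m) : ℝ≥0∞ :=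
  ⨅ δ : dp.Procedure, dp.finAddBayesRisk π δ

end DecisionProblem

/-- The probability measure `π` is concentrated on a finite set. -/
def FinitelySupported {Θ : Type*} [MeasurableSpace Θ] (π : ProbabilityMeasure Θ) : Prop :=
  ∃ S : Finset Θ, (π : Measure Θ) (↑S : Set Θ)ᶜ = 0

/-! The upper bounds are immediate: averaging a risk function over a prior, even a finitely additive
one, cannot exceed its supremum. For the lower bound, the common Lipschitz constant and total
boundedness give one finite net on which the maximal risk of every procedure is within `ε` of its
supremum. Randomizing between procedures makes the risk vectors on the net a convex set, and each
vector has a coordinate at least the minimax value minus `ε`. Hahn-Banach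
(`exists_mem_stdSimplex_forall_le_sum`) turns this into one weight vector good for all procedures: a
finitely supported prior that is least favourable up to `ε`. -/

/-- If every point of a nonempty convex set of vectors has a coordinate that is at least `c`, then
some fixed convex combination of the coordinates is at least `c` on the whole set. -/
theorem exists_mem_stdSimplex_forall_le_sum {ι : Type*} [Fintype ι] {R : Set (ι → ℝ)}
    (hR : Convex ℝ R) (hne : R.Nonempty) {c : ℝ} (h : ∀ r ∈ R, ∃ i, c ≤ r i) :
    ∃ w ∈ stdSimplex ℝ ι, ∀ r ∈ R, c ≤ ∑ i, w i * r i := by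
  classical
  set C : Set (ι → ℝ) := Set.pi Set.univ fun _ => Set.Iio c
  have hCR : Disjoint C R := by
    rw [Set.disjoint_left]
    intro r hrC hrR
    obtain ⟨i, hi⟩ := h r hrR
    exact absurd (hrC i trivial) (not_lt.2 hi)
  -- The open orthant below `c` misses `R`, so some functional satisfies `f < u` on the orthant and
  -- `u ≤ f` on `R`. Its coefficients, normalized, are the weights.
  obtain ⟨f, u, hfC, hfR⟩ := geometric_hahn_banach_open
    (convex_pi fun _ _ => convex_Iio c) (isOpen_set_pi Set.finite_univ fun _ _ => isOpen_Iio) hR hCR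
  set w : ι → ℝ := fun i => f (Pi.single i 1) with hw
  have hf : ∀ v, f v = ∑ i, w i * v i := fun v => by
    conv_lhs => rw [pi_eq_sum_univ' v]
    simp [hw, mul_comm]
  have hconst : ∀ ε > 0, (∑ i, w i) * (c - ε) < u := fun ε hε => by
    have := hfC (fun _ => c - ε) fun i _ => by simpa using hε
    rwa [hf, ← Finset.sum_mul] at this
  have hw0 : ∀ i, 0 ≤ w i := by
    intro i
    by_contra! hi
    -- If `w i < 0`, lowering coordinate `i` by `d / -w i` stays in the orthant but raises `f` by
    -- the whole gap `d`, up to `u`.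
    set d := u - (∑ i, w i) * (c - 1) with hd
    have hd0 : 0 < d := sub_pos.2 (hconst 1 one_pos)
    have hs : 0 < d / -w i := div_pos hd0 (neg_pos.2 hi)
    have := hfC ((fun _ => c - 1) - (d / -w i) • Pi.single i 1) fun j _ => by
      by_cases hij : j = i
      · subst hij; simp only [Pi.sub_apply, Pi.smul_apply, Pi.single_eq_same, smul_eq_mul,
          Set.mem_Iio]; linarith
      · simp [Pi.single_eq_of_ne hij]
    rw [map_sub, map_smul, hf (fun _ => c - 1), ← Finset.sum_mul] at this
    change _ - (d / -w i) * w i < u at this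
    have h2 : d / -w i * w i = -d := by field_simp [hi.ne]
    rw [h2] at this
    linarith
  have hW : 0 < ∑ i, w i := by
    -- Otherwise `f = 0`, whence `0 < u` from the orthant and `u ≤ 0` from a point of `R`.
    refine (Finset.sum_nonneg fun i _ => hw0 i).lt_of_ne fun h0 => ?_
    have hz := (Finset.sum_eq_zero_iff_of_nonneg fun i _ => hw0 i).1 h0.symm
    obtain ⟨b, hb⟩ := hne
    have h1 := hfR b hb
    have h2 := hconst 1 one_pos
    rw [hf, Finset.sum_eq_zero fun i hi => by rw [hz i hi, zero_mul]] at h1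
    rw [← h0] at h2
    linarith
  have hcu : (∑ i, w i) * c ≤ u := by
    refine le_of_forall_pos_lt_add fun ε hε => ?_
    have := hconst (ε / ∑ i, w i) (div_pos hε hW)
    rw [mul_sub, mul_div_cancel₀ _ hW.ne'] at this
    linarith
  refine ⟨fun i => w i / ∑ j, w j, ⟨fun i => div_nonneg (hw0 i) hW.le, ?_⟩, fun r hr => ?_⟩
  · rw [← Finset.sum_div, div_self hW.ne']
  · have := hcu.trans (hfR r hr)
    rw [hf] at this
    simp_rw [div_mul_eq_mul_div]
    rwa [← Finset.sum_div, le_div_iff₀' hW]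

namespace FinAddProb

variable {Θ : Type*} {m : MeasurableSpace Θ}

/-- The finitely many fibres of a simple function partition the space, so finite additivity
suffices. -/
theorem integral_le_of_forall_le (π : FinAddProb m) {f : Θ → ℝ≥0∞} {c : ℝ≥0∞}
    (h : ∀ θ, f θ ≤ c) : π.integral f ≤ c := by
  refine iSup₂_le fun g hg => ?_
  have hU : (⋃ y ∈ g.range, g ⁻¹' {y}) = Set.univ := by
    ext θ
    simp
  calc ∑ y ∈ g.range, y * π.content (g ⁻¹' {y})
      ≤ ∑ y ∈ g.range, c * π.content (g ⁻¹' {y}) := by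
        refine Finset.sum_le_sum fun y hy => ?_
        obtain ⟨θ, rfl⟩ := SimpleFunc.mem_range.1 hy
        gcongr
        exact (hg θ).trans (h θ)
    _ = c * π.content (⋃ y ∈ g.range, g ⁻¹' {y}) := by
        rw [addContent_biUnion (m := π.content) (fun y _ => g.measurableSet_fiber y)
          (Set.pairwiseDisjoint_fiber g _) (by rw [hU]; exact MeasurableSet.univ),
          Finset.mul_sum]
    _ = c := by rw [hU, π.content_univ, mul_one]

/-- A countably additive probability measure, seen as a finitely additive one. -/
noncomputable def ofMeasure (μ : @Measure Θ m) [IsProbabilityMeasure μ] : FinAddProb m where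
  content :=
    { toFun := μ
      empty' := measure_empty
      sUnion' := fun I hI hd _ => by
        rw [Set.sUnion_eq_biUnion]
        exact measure_biUnion_finset hd fun s hs => hI hs }
  content_univ := measure_univ (μ := μ)

/-- Both sides are the same supremum over simple functions, so no measurability of `f` is needed. -/
theorem integral_ofMeasure (μ : @Measure Θ m) [IsProbabilityMeasure μ] (f : Θ → ℝ≥0∞) :
    (ofMeasure μ).integral f = ∫⁻ θ, f θ ∂μ := by
  rw [lintegral]
  rfl

end FinAddProb

/-- The finitely supported measure `∑ i, w i • δ_(p i)`. -/
noncomputable def weightedDirac {Θ ι : Type*} [Fintype ι] (m : MeasurableSpace Θ) (p : ι → Θ)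
    (w : ι → ℝ) : Measure Θ :=
  ∑ i, ENNReal.ofReal (w i) • Measure.dirac (p i)

theorem isProbabilityMeasure_weightedDirac {Θ ι : Type*} [Fintype ι] (m : MeasurableSpace Θ)
    (p : ι → Θ) {w : ι → ℝ} (hw : w ∈ stdSimplex ℝ ι) :
    IsProbabilityMeasure (weightedDirac m p w) := by
  constructor
  simp [weightedDirac, ← ENNReal.ofReal_sum_of_nonneg fun i _ => hw.1 i, hw.2]

theorem lintegral_weightedDirac {Θ ι : Type*} [Fintype ι] (m : MeasurableSpace Θ)
    [MeasurableSingletonClass Θ] (p : ι → Θ) (w : ι → ℝ) (f : Θ → ℝ≥0∞) :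
    ∫⁻ θ, f θ ∂(weightedDirac m p w) = ∑ i, ENNReal.ofReal (w i) * f (p i) := by
  simp [weightedDirac, lintegral_finsetSum_measure]

namespace DecisionProblem

variable {Θ X A : Type*} [MeasurableSpace X] [MeasurableSpace A] {dp : DecisionProblem Θ X A}

theorem lintegral_convexComb (μ ν : ProbabilityMeasure A) (a b : ℝ≥0) (f : A → ℝ≥0∞) :
    ∫⁻ y, f y ∂(a • (μ : Measure A) + b • (ν : Measure A)) =
      a * ∫⁻ y, f y ∂(μ : Measure A) + b * ∫⁻ y, f y ∂(ν : Measure A) := by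
  rw [lintegral_add_measure, lintegral_smul_measure, lintegral_smul_measure]
  rfl

/-- The procedure that randomizes between `δ` and `δ'` with probabilities `a` and `b`. -/
noncomputable def Procedure.convexComb (δ δ' : dp.Procedure) (a b : ℝ≥0) (hab : a + b = 1) :
    dp.Procedure where
  toFun x := ⟨a • (δ.toFun x : Measure A) + b • (δ'.toFun x : Measure A),
    ⟨by
      rw [Measure.add_apply, Measure.smul_apply, Measure.smul_apply, measure_univ, measure_univ,
        ENNReal.smul_def, ENNReal.smul_def, smul_eq_mul, smul_eq_mul, mul_one, mul_one]
      exact_mod_cast hab⟩⟩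
  measurable_expectedLoss θ := by
    simp only [ProbabilityMeasure.coe_mk, lintegral_convexComb]
    exact ((δ.measurable_expectedLoss θ).const_mul _).add
      ((δ'.measurable_expectedLoss θ).const_mul _)

theorem risk_convexComb (δ δ' : dp.Procedure) (a b : ℝ≥0) (hab : a + b = 1) (θ : Θ) :
    dp.risk θ (δ.convexComb δ' a b hab) = a * dp.risk θ δ + b * dp.risk θ δ' := by
  simp only [risk, Procedure.convexComb, ProbabilityMeasure.coe_mk, lintegral_convexComb]
  rw [lintegral_add_left ((δ.measurable_expectedLoss θ).const_mul _),
    lintegral_const_mul _ (δ.measurable_expectedLoss θ),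
    lintegral_const_mul _ (δ'.measurable_expectedLoss θ)]

/-- Risk is affine under randomization between two procedures; finiteness lets this pass to real
numbers. -/
theorem convex_range_risk {ι : Type*} (p : ι → Θ) (hfin : ∀ θ (δ : dp.Procedure), dp.risk θ δ ≠ ∞) :
    Convex ℝ (Set.range fun (δ : dp.Procedure) (i : ι) => (dp.risk (p i) δ).toReal) := by
  rintro _ ⟨δ, rfl⟩ _ ⟨δ', rfl⟩ a b ha hb hab
  lift a to ℝ≥0 using ha
  lift b to ℝ≥0 using hb
  refine ⟨δ.convexComb δ' a b (by exact_mod_cast hab), ?_⟩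
  ext i
  simp only [risk_convexComb]
  rw [ENNReal.toReal_add (ENNReal.mul_ne_top ENNReal.coe_ne_top (hfin _ _))
    (ENNReal.mul_ne_top ENNReal.coe_ne_top (hfin _ _))]
  simp

theorem nonempty_procedure (hfin : dp.minimaxValue < ∞) : Nonempty dp.Procedure := by
  by_contra h
  rw [not_nonempty_iff] at h
  simp [minimaxValue] at hfin

theorem bayesValue_le_minimaxValue [MeasurableSpace Θ] (π : ProbabilityMeasure Θ) :
    dp.bayesValue π ≤ dp.minimaxValue :=
  iInf_mono fun δ => (lintegral_mono fun θ => le_iSup (fun θ => dp.risk θ δ) θ).trans (by simp)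

theorem finAddBayesValue_le_minimaxValue {m : MeasurableSpace Θ} (π : FinAddProb m) :
    dp.finAddBayesValue π ≤ dp.minimaxValue :=
  iInf_mono fun δ => π.integral_le_of_forall_le fun θ => le_iSup (fun θ => dp.risk θ δ) θ

/-- On a fine enough finite net, the largest risk almost attains the minimax value. -/
theorem exists_finset_forall_minimaxValue_sub_le_risk [MetricSpace Θ] [Nonempty Θ]
    (htb : TotallyBounded (Set.univ : Set Θ)) {k : ℝ≥0}
    (hlip : ∀ δ : dp.Procedure, dp.RiskLipschitz k δ) {ε : ℝ} (hε : 0 < ε) :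
    ∃ t : Finset Θ, ∀ δ : dp.Procedure,
      ∃ i : t, dp.minimaxValue.toReal - ε ≤ (dp.risk i δ).toReal := by
  -- With this radius a risk function varies by at most `k * (ε / (k + 1)) ≤ ε` between a point and
  -- a nearby net point; the `+ 1` covers `k = 0`.
  have hη : 0 < ε / (k + 1) := by positivity
  obtain ⟨t, ht, hcov⟩ := Metric.totallyBounded_iff.1 htb _ hη
  lift t to Finset Θ using ht
  have hne : t.Nonempty := by
    obtain ⟨y, hy, -⟩ := Set.mem_iUnion₂.1 (hcov (Set.mem_univ (Classical.arbitrary Θ)))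
    exact ⟨y, hy⟩
  refine ⟨t, fun δ => ?_⟩
  obtain ⟨i, hi, hmax⟩ := t.exists_max_image (fun i => (dp.risk i δ).toReal) hne
  refine ⟨⟨i, hi⟩, ?_⟩
  rw [sub_le_iff_le_add]
  refine ENNReal.toReal_le_of_le_ofReal (by positivity) ?_
  refine iInf_le_of_le δ (iSup_le fun θ => ?_)
  rw [← ENNReal.ofReal_toReal ((hlip δ).1 θ)]
  refine ENNReal.ofReal_le_ofReal ?_
  obtain ⟨y, hy, hθ⟩ := Set.mem_iUnion₂.1 (hcov (Set.mem_univ θ))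
  have h1 := ((hlip δ).2.dist_le_mul θ y).trans
    (mul_le_mul_of_nonneg_left (Metric.mem_ball.1 hθ).le k.2)
  have h2 : (k : ℝ) * (ε / (k + 1)) ≤ ε := by
    rw [mul_div_assoc', div_le_iff₀ (by positivity)]
    nlinarith
  have h3 := hmax y hy
  have h4 := (le_abs_self _).trans (h1.trans h2)
  linarith

/-- For some finitely supported weights, the weighted risk of every procedure almost attains the
minimax value. -/
theorem exists_weights_forall_minimaxValue_le [MetricSpace Θ] [Nonempty Θ]
    (htb : TotallyBounded (Set.univ : Set Θ)) (hfin : dp.minimaxValue < ∞) {k : ℝ≥0}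
    (hlip : ∀ δ : dp.Procedure, dp.RiskLipschitz k δ) {ε : ℝ} (hε : 0 < ε) :
    ∃ t : Finset Θ, ∃ w ∈ stdSimplex ℝ t, ∀ δ : dp.Procedure,
      dp.minimaxValue ≤ ∑ i, ENNReal.ofReal (w i) * dp.risk i δ + ENNReal.ofReal ε := by
  obtain ⟨t, ht⟩ := exists_finset_forall_minimaxValue_sub_le_risk htb hlip hε
  have := nonempty_procedure hfin
  obtain ⟨w, hw, h⟩ := exists_mem_stdSimplex_forall_le_sum
    (convex_range_risk (fun i : t => (i : Θ)) fun θ δ => (hlip δ).1 θ) (Set.range_nonempty _)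
    (by rintro _ ⟨δ, rfl⟩; exact ht δ)
  refine ⟨t, w, hw, fun δ => ?_⟩
  have hsum : ∑ i, ENNReal.ofReal (w i) * dp.risk i δ =
      ENNReal.ofReal (∑ i, w i * (dp.risk i δ).toReal) := by
    rw [ENNReal.ofReal_sum_of_nonneg fun i _ => mul_nonneg (hw.1 i) ENNReal.toReal_nonneg]
    refine Finset.sum_congr rfl fun i _ => ?_
    rw [ENNReal.ofReal_mul (hw.1 i), ENNReal.ofReal_toReal ((hlip δ).1 i)]
  rw [hsum, ← ENNReal.ofReal_add (Finset.sum_nonneg fun i _ =>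
    mul_nonneg (hw.1 i) ENNReal.toReal_nonneg) hε.le, ← ENNReal.ofReal_toReal hfin.ne]
  exact ENNReal.ofReal_le_ofReal (sub_le_iff_le_add.1 (h _ ⟨δ, rfl⟩))

theorem exists_finitelySupported_minimaxValue_le [MetricSpace Θ] [Nonempty Θ]
    [MeasurableSpace Θ] [MeasurableSingletonClass Θ]
    (htb : TotallyBounded (Set.univ : Set Θ)) (hfin : dp.minimaxValue < ∞) {k : ℝ≥0}
    (hlip : ∀ δ : dp.Procedure, dp.RiskLipschitz k δ) {ε : ℝ} (hε : 0 < ε) :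
    ∃ π : ProbabilityMeasure Θ, FinitelySupported π ∧
      dp.minimaxValue ≤ dp.bayesValue π + ENNReal.ofReal ε := by
  obtain ⟨t, w, hw, h⟩ := exists_weights_forall_minimaxValue_le htb hfin hlip hε
  refine ⟨⟨weightedDirac _ (fun i : t => (i : Θ)) w, isProbabilityMeasure_weightedDirac _ _ hw⟩,
    ⟨t, ?_⟩, ?_⟩
  · simp [weightedDirac, Measure.dirac_apply]
  · simp only [bayesValue, ENNReal.iInf_add]
    refine le_iInf fun δ => ?_
    simpa only [bayesRisk, ProbabilityMeasure.coe_mk, lintegral_weightedDirac] using h δ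

theorem minimaxValue_eq_iSup_bayesValue [MetricSpace Θ] [Nonempty Θ]
    [MeasurableSpace Θ] [MeasurableSingletonClass Θ]
    (htb : TotallyBounded (Set.univ : Set Θ)) (hfin : dp.minimaxValue < ∞) {k : ℝ≥0}
    (hlip : ∀ δ : dp.Procedure, dp.RiskLipschitz k δ) :
    dp.minimaxValue = ⨆ π : ProbabilityMeasure Θ, dp.bayesValue π := by
  refine le_antisymm (ENNReal.le_of_forall_pos_le_add fun ε hε _ => ?_)
    (iSup_le bayesValue_le_minimaxValue)
  obtain ⟨π, -, hπ⟩ := exists_finitelySupported_minimaxValue_le htb hfin hlip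
    (NNReal.coe_pos.2 hε)
  rw [ENNReal.ofReal_coe_nnreal] at hπ
  exact hπ.trans (by gcongr; exact le_iSup dp.bayesValue π)

theorem bayesValue_eq_finAddBayesValue_ofMeasure [MeasurableSpace Θ] (π : ProbabilityMeasure Θ) :
    dp.bayesValue π = dp.finAddBayesValue (FinAddProb.ofMeasure (π : Measure Θ)) := by
  simp only [bayesValue, bayesRisk, finAddBayesValue, finAddBayesRisk,
    FinAddProb.integral_ofMeasure]

/-- Countably additive priors on `m` are finitely additive ones with the same Bayes value. Only
measurable singletons are required, so `m` can be the Borel σ-algebra or the full power set. -/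
theorem minimaxValue_eq_iSup_finAddBayesValue [MetricSpace Θ] [Nonempty Θ]
    (m : MeasurableSpace Θ) [MeasurableSingletonClass Θ]
    (htb : TotallyBounded (Set.univ : Set Θ)) (hfin : dp.minimaxValue < ∞) {k : ℝ≥0}
    (hlip : ∀ δ : dp.Procedure, dp.RiskLipschitz k δ) :
    dp.minimaxValue = ⨆ π : FinAddProb m, dp.finAddBayesValue π := by
  refine le_antisymm ?_ (iSup_le finAddBayesValue_le_minimaxValue)
  rw [minimaxValue_eq_iSup_bayesValue htb hfin hlip]
  refine iSup_le fun π => ?_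
  rw [bayesValue_eq_finAddBayesValue_ofMeasure]
  exact le_iSup dp.finAddBayesValue _

end DecisionProblem

theorem mainTheorem4 {Θ X A : Type*} [MetricSpace Θ] [TopologicalSpace.SeparableSpace Θ]
    [MeasurableSpace Θ] [BorelSpace Θ] [Nonempty Θ] [MeasurableSpace X] [MeasurableSpace A]
    (htb : TotallyBounded (Set.univ : Set Θ))
    (dp : DecisionProblem Θ X A)
    (hfin : dp.minimaxValue < ∞)
    (k : ℕ) (hlip : ∀ δ : dp.Procedure, dp.RiskLipschitz (k : ℝ≥0) δ) :
    dp.minimaxValue = (⨆ π : ProbabilityMeasure Θ, dp.bayesValue π) ∧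
    dp.minimaxValue = (⨆ π : FinAddProb (borel Θ), dp.finAddBayesValue π) ∧
    dp.minimaxValue = (⨆ π : FinAddProb (⊤ : MeasurableSpace Θ), dp.finAddBayesValue π) ∧
    ∃ π : ℕ → ProbabilityMeasure Θ,
      (∀ n, FinitelySupported (π n)) ∧
      Tendsto (fun n => dp.bayesValue (π n)) atTop (𝓝 dp.minimaxValue) := by
  have hborel : @MeasurableSingletonClass Θ (borel Θ) := by
    rw [← BorelSpace.measurable_eq (α := Θ)]
    infer_instance
  refine ⟨DecisionProblem.minimaxValue_eq_iSup_bayesValue htb hfin hlip,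
    DecisionProblem.minimaxValue_eq_iSup_finAddBayesValue (borel Θ) htb hfin hlip,
    @DecisionProblem.minimaxValue_eq_iSup_finAddBayesValue _ _ _ _ _ dp _ _ ⊤
      (@MeasurableSingletonClass.mk _ ⊤ fun _ => trivial) htb hfin _ hlip, ?_⟩
  have hpos : ∀ n : ℕ, (0 : ℝ) < 1 / ((n : ℝ) + 1) := fun n => Nat.one_div_pos_of_nat
  choose π hsupp hπ using fun n =>
    DecisionProblem.exists_finitelySupported_minimaxValue_le htb hfin hlip (hpos n)
  refine ⟨π, hsupp, ?_⟩
  -- The Bayes values are squeezed between this sequence and the minimax value; subtraction is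
  -- continuous here because the latter is finite.
  have hlim : Tendsto (fun n : ℕ => dp.minimaxValue - ENNReal.ofReal (1 / ((n : ℝ) + 1))) atTop
      (𝓝 dp.minimaxValue) := by
    have h0 := ENNReal.tendsto_ofReal (tendsto_one_div_add_atTop_nhds_zero_nat (𝕜 := ℝ))
    rw [ENNReal.ofReal_zero] at h0
    simpa using ENNReal.Tendsto.sub tendsto_const_nhds h0 (Or.inl hfin.ne)
  exact tendsto_of_tendsto_of_tendsto_of_le_of_le hlim tendsto_const_nhds
    (fun n => tsub_le_iff_right.2 (hπ n))
    fun n => DecisionProblem.bayesValue_le_minimaxValue (π n)
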